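/- Let $g:\mathbb{R}\to\mathbb{R}$ be measurable, nonnegative on $[0,\infty)$, with $0<\int_{\mathbb{R}} g(z^2/2)\,dz<\infty$. Put $k=\big(\int_{\mathbb{R}} g(z^2/2)\,dz\big)^{-1}$, $\Phi(a)=\int_{-\infty}^a k\,g(z^2/2)\,dz$, and $\Phi^{-1}(p)=\inf\{x\in\mathbb{R}:\Phi(x)\ge p\}$ for $p\in(0,1)$ (the ordinary inverse where $\Phi$ is invertible). For $\mu\in\mathbb{R}$ and $\Sigma>0$ let $\mathbb{P}_R(\mu,\Sigma,g)$ be the one-dimensional elliptical distribution on $\mathbb{R}$, i.e. the probability measure whose density is proportional to $g\big(\tfrac12 (x-\mu)\Sigma^{-1}(x-\mu)\big)$. For probability measures $\mathbb{P}_1,\mathbb{P}_2$ on $\mathbb{R}$ let $$d_w(\mathbb{P}_1,\mathbb{P}_2)=\inf_{\pi}\int \|m_1-m_2\|_\Sigma\,d\pi(m_1,m_2)\in[0,\infty],\qquad \|v\|_\Sigma=\sqrt{v\,\Sigma^{-1}v},$$ where $\pi$ ranges over the joint distributions on $\mathbb{R}\times\mathbb{R}$ with marginals $\mathbb{P}_1$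 and $\mathbb{P}_2$ (the Wasserstein distance for the Mahalanobis norm associated with $\Sigma$), and for $\theta_w>0$ let $\mathcal{F}_w(\mathbb{P}_R,\theta_w)$ be the set of probability measures $\mathbb{P}$ on $\mathbb{R}$ with $d_w(\mathbb{P},\mathbb{P}_R)\le\theta_w$. Let $\theta_w>0$ and $\alpha\in(0,\tfrac12]$. Then the optimization problem $$\min_{\eta\in\mathbb{R}}\ \eta\quad\text{s.t.}\quad \eta\ge\Phi^{-1}(1-\alpha),\qquad \eta\big(\Phi(\eta)-(1-\alpha)\big)-\int_{\frac12(\Phi^{-1}(1-\alpha))^2}^{\eta^2/2}k\,g(z)\,dz\ \ge\ \theta_w$$ has a minimizer $\eta^*$, and for all $\mu\in\mathbb{R}$, $\Sigma>0$ (in applications, the mean and the variance of a scalar random variable $\boldsymbol{x}$ whose law $\mathbb{P}_{\boldsymbol{x}}$ is only known to lie in the ambiguity set) and all $a\in\mathbb{R}$, writing $\mathbb{P}_R=\mathbb{P}_R(\mu,\Sigma,g)$, $$\inf_{\mathbb{P}_{\boldsymbol{x}}\in\mathcal{F}_w(\mathbb{P}_R,\theta_w)}\mathbb{P}_{\boldsymbol{x}}\big([a,\infty)\big)\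 \ge\ 1-\alpha\quad\Longleftrightarrow\quad \mu\ \ge\ a+\eta^*\,\Sigma^{1/2}.$$ -/

import Mathlib

open MeasureTheory
open scoped ENNReal

noncomputable section

namespace WassersteinChance

/-- The set of joint distributions on `E × E` with marginals `P₁` and `P₂`. -/
def couplings {E : Type*} [MeasurableSpace E] (P₁ P₂ : Measure E) : Set (Measure (E × E)) :=
  {π | π.map Prod.fst = P₁ ∧ π.map Prod.snd = P₂}

/-- The (type-1) Wasserstein distance between two distributions, where moving a unit mass from
`m₁` to `m₂` costs `N (m₁ - m₂)` for a given norm `N`. It may be infinite. -/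
def wassersteinDist {E : Type*} [MeasurableSpace E] [Sub E] (N : E → ℝ) (P₁ P₂ : Measure E) :
    ℝ≥0∞ :=
  ⨅ π ∈ couplings P₁ P₂, ∫⁻ m, ENNReal.ofReal (N (m.1 - m.2)) ∂π

/-- The Wasserstein ambiguity set: all probability distributions within Wasserstein distance `θ`
of the reference distribution `PR`. -/
def ambiguitySet {E : Type*} [MeasurableSpace E] [Sub E] (N : E → ℝ) (PR : Measure E) (θ : ℝ) :
    Set (Measure E) :=
  {P | IsProbabilityMeasure P ∧ wassersteinDist N P PR ≤ ENNReal.ofReal θ}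

/-- The Mahalanobis norm `√(vᵀ S⁻¹ v)` on the real line. -/
def mahalanobis (S v : ℝ) : ℝ := √(v * S⁻¹ * v)

/-- `g` generates a one-dimensional elliptical density: it is measurable, nonnegative on the
half-line where it is evaluated, and the total mass of `g (z² / 2)` is finite and positive, so
that it can be normalized. -/
structure IsDensityGenerator (g : ℝ → ℝ) : Prop where
  measurable : Measurable g
  nonneg : ∀ u, 0 ≤ u → 0 ≤ g u
  integrable : Integrable (fun z : ℝ => g (z ^ 2 / 2)) volume
  mass_pos : 0 < ∫ z : ℝ, g (z ^ 2 / 2)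

/-- The density of the elliptical distribution with location `μ`, dispersion `S` and generator
`g`: the function `g ((x - μ)ᵀ S⁻¹ (x - μ) / 2)`, normalized to have integral one. -/
def ellipticalDensity (μ S : ℝ) (g : ℝ → ℝ) (x : ℝ) : ℝ :=
  (∫ y : ℝ, g (1 / 2 * ((y - μ) * S⁻¹ * (y - μ))))⁻¹ * g (1 / 2 * ((x - μ) * S⁻¹ * (x - μ)))

/-- The one-dimensional elliptical distribution with parameters `μ`, `S`, `g`. -/
def elliptical (μ S : ℝ) (g : ℝ → ℝ) : Measure ℝ :=
  volume.withDensity fun x => ENNReal.ofReal (ellipticalDensity μ S g x)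

/-- The normalization constant `k` of the standard elliptical density `k * g (z² / 2)`. -/
def stdConst (g : ℝ → ℝ) : ℝ := (∫ z : ℝ, g (z ^ 2 / 2))⁻¹

/-- The cumulative distribution function `Φ` of the standard elliptical distribution. -/
def stdCDF (g : ℝ → ℝ) (a : ℝ) : ℝ := ∫ z in Set.Iic a, stdConst g * g (z ^ 2 / 2)

/-- The (generalized) inverse `Φ⁻¹` of the standard elliptical distribution function. It is the
ordinary inverse wherever `Φ` is invertible. -/
def stdQuantile (g : ℝ → ℝ) (p : ℝ) : ℝ := sInf {x : ℝ | p ≤ stdCDF g x}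

/-- The feasible set of the optimization problem that defines `η*`. -/
def etaFeasible (g : ℝ → ℝ) (θ α : ℝ) : Set ℝ :=
  {η | stdQuantile g (1 - α) ≤ η ∧
    θ ≤ η * (stdCDF g η - (1 - α)) -
      ∫ z in (1 / 2 * stdQuantile g (1 - α) ^ 2)..(η ^ 2 / 2), stdConst g * g z}

end WassersteinChance

end

noncomputable section

namespace WassersteinChance

open Set Filter Topology

/-! Standardize by x = μ - √S z: the reference law becomes the standard one, the Mahalanobis cost
becomes |z - z'|, and the event x ≥ a becomes z ≤ t with t = (μ - a)/√S. With q = Φ⁻¹(1 - α), the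
cheapest way to spoil the constraint is to push the mass of (q, t] just beyond t, at cost C(q, t) =
∫ (t - z) φ(z) dz over (q, t], where C is `transportCost` and φ is `stdDensity`. Substituting u =
z²/2 shows that C(q, η) is the left side of the constraint defining η*, so η* is the least η ≥ q
with C(q, η) ≥ θ (`etaFeasible_eq`).

If t ≥ η*, a Kantorovich dual potential, the clamp of z - q to [0, η* - q], bounds the mass below a
by α for every law in the ball (`le_measure_Ici_of_le_transportCost`). If t < η*, minimality gives
C(q, max q t) < θ, and the slack pays for moving slightly more than α of mass strictly beyond t
(`exists_mem_ambiguitySet`). -/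

/-- The density of the standard elliptical distribution with generator `g`. -/
def stdDensity (g : ℝ → ℝ) (z : ℝ) : ℝ := stdConst g * g (z ^ 2 / 2)

/-- The standard elliptical distribution with generator `g`. -/
def stdElliptical (g : ℝ → ℝ) : Measure ℝ :=
  volume.withDensity fun z => ENNReal.ofReal (stdDensity g z)

/-- The cost of moving to `y` the mass that the standard elliptical distribution has on
the interval from `x` to `y`. -/
def transportCost (g : ℝ → ℝ) (x y : ℝ) : ℝ := ∫ z in x..y, (y - z) * stdDensity g z

variable {g : ℝ → ℝ}

/-! ### The standard elliptical law and its distribution function -/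

section StandardDistribution

lemma stdConst_pos (hg : IsDensityGenerator g) : 0 < stdConst g := inv_pos.2 hg.mass_pos

lemma measurable_stdDensity (hg : IsDensityGenerator g) : Measurable (stdDensity g) :=
  (hg.measurable.comp (by fun_prop)).const_mul _

lemma stdDensity_nonneg (hg : IsDensityGenerator g) (z : ℝ) : 0 ≤ stdDensity g z :=
  mul_nonneg (stdConst_pos hg).le (hg.nonneg _ (by positivity))

lemma integrable_stdDensity (hg : IsDensityGenerator g) : Integrable (stdDensity g) :=
  hg.integrable.const_mul _

lemma integral_stdDensity (hg : IsDensityGenerator g) : ∫ z, stdDensity g z = 1 := by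
  simp only [stdDensity, integral_const_mul]
  exact inv_mul_cancel₀ hg.mass_pos.ne'

lemma stdElliptical_apply (hg : IsDensityGenerator g) {A : Set ℝ} (hA : MeasurableSet A) :
    stdElliptical g A = ENNReal.ofReal (∫ z in A, stdDensity g z) := by
  rw [stdElliptical, withDensity_apply _ hA, ofReal_integral_eq_lintegral_ofReal
    (integrable_stdDensity hg).integrableOn (ae_of_all _ (stdDensity_nonneg hg))]

lemma stdElliptical_Iic (hg : IsDensityGenerator g) (x : ℝ) :
    stdElliptical g (Iic x) = ENNReal.ofReal (stdCDF g x) :=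
  stdElliptical_apply hg measurableSet_Iic

lemma isProbabilityMeasure_stdElliptical (hg : IsDensityGenerator g) :
    IsProbabilityMeasure (stdElliptical g) :=
  ⟨by rw [stdElliptical_apply hg MeasurableSet.univ, Measure.restrict_univ,
    integral_stdDensity hg, ENNReal.ofReal_one]⟩

lemma lintegral_stdElliptical_ofReal (hg : IsDensityGenerator g) {f : ℝ → ℝ} (hf : Measurable f)
    (hf0 : ∀ z, 0 ≤ f z) (hi : Integrable fun z => f z * stdDensity g z) :
    ∫⁻ z, ENNReal.ofReal (f z) ∂stdElliptical g
      = ENNReal.ofReal (∫ z, f z * stdDensity g z) := by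
  rw [stdElliptical, lintegral_withDensity_eq_lintegral_mul _
    (measurable_stdDensity hg).ennreal_ofReal hf.ennreal_ofReal,
    ofReal_integral_eq_lintegral_ofReal hi
      (ae_of_all _ fun z => mul_nonneg (hf0 z) (stdDensity_nonneg hg z))]
  refine lintegral_congr fun z => ?_
  rw [ENNReal.ofReal_mul (hf0 z), Pi.mul_apply, mul_comm]

lemma stdCDF_sub (hg : IsDensityGenerator g) (x y : ℝ) :
    stdCDF g y - stdCDF g x = ∫ z in x..y, stdDensity g z :=
  intervalIntegral.integral_Iic_sub_Iic (integrable_stdDensity hg).integrableOn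
    (integrable_stdDensity hg).integrableOn

lemma integral_Ioi_stdDensity (hg : IsDensityGenerator g) (x : ℝ) :
    ∫ z in Ioi x, stdDensity g z = 1 - stdCDF g x := by
  rw [← integral_stdDensity hg, ← intervalIntegral.integral_Iic_add_Ioi
    (integrable_stdDensity hg).integrableOn (integrable_stdDensity hg).integrableOn]
  exact (add_sub_cancel_left _ _).symm

lemma stdCDF_mono (hg : IsDensityGenerator g) : Monotone (stdCDF g) := fun x y hxy => by
  rw [← sub_nonneg, stdCDF_sub hg]
  exact intervalIntegral.integral_nonneg hxy fun z _ => stdDensity_nonneg hg z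

lemma continuous_stdCDF (hg : IsDensityGenerator g) : Continuous (stdCDF g) := by
  have h : stdCDF g = fun x => stdCDF g 0 + ∫ z in (0 : ℝ)..x, stdDensity g z := by
    funext x
    rw [← stdCDF_sub hg]
    ring
  rw [h]
  exact continuous_const.add (intervalIntegral.continuous_primitive
    (fun a b => (integrable_stdDensity hg).intervalIntegrable) 0)

lemma tendsto_stdCDF_atBot : Tendsto (stdCDF g) atBot (𝓝 0) :=
  tendsto_integral_Iic_zero tendsto_id

lemma tendsto_stdCDF_atTop (hg : IsDensityGenerator g) : Tendsto (stdCDF g) atTop (𝓝 1) := by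
  rw [← integral_stdDensity hg]
  exact (aecover_Iic tendsto_id).integral_tendsto_of_countably_generated (integrable_stdDensity hg)

end StandardDistribution

/-! ### The generalized inverse of Φ -/

section Quantile

variable {p : ℝ}

lemma bddBelow_setOf_le_stdCDF (hg : IsDensityGenerator g) (hp : 0 < p) :
    BddBelow {x | p ≤ stdCDF g x} := by
  obtain ⟨c, hc⟩ := (tendsto_stdCDF_atBot (g := g)).eventually_lt_const hp |>.exists
  refine ⟨c, fun x hx => ?_⟩
  by_contra! h
  exact absurd (hx.trans (stdCDF_mono hg h.le)) (not_le.2 hc)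

lemma stdCDF_lt_of_lt_stdQuantile (hg : IsDensityGenerator g) (hp : 0 < p) {x : ℝ}
    (hx : x < stdQuantile g p) : stdCDF g x < p := by
  by_contra! h
  exact absurd (csInf_le (bddBelow_setOf_le_stdCDF hg hp) h) (not_le.2 hx)

/-- Φ has no jumps, so the level p is hit exactly, even when Φ is flat there and the quantile is the
left end of the flat piece. -/
lemma stdCDF_stdQuantile (hg : IsDensityGenerator g) (hp : 0 < p) (hp1 : p < 1) :
    stdCDF g (stdQuantile g p) = p := by
  apply le_antisymm
  · have h : Tendsto (stdCDF g) (𝓝[<] stdQuantile g p) (𝓝 (stdCDF g (stdQuantile g p))) :=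
      (continuous_stdCDF hg).continuousAt.mono_left nhdsWithin_le_nhds
    refine le_of_tendsto h ?_
    filter_upwards [self_mem_nhdsWithin] with x hx
    exact (stdCDF_lt_of_lt_stdQuantile hg hp hx).le
  · have hne : {x | p ≤ stdCDF g x}.Nonempty :=
      ((tendsto_stdCDF_atTop hg).eventually_const_le hp1).exists
    exact (isClosed_le continuous_const (continuous_stdCDF hg)).csInf_mem hne
      (bddBelow_setOf_le_stdCDF hg hp)

end Quantile

/-! ### Transport cost and existence of η* -/

section TransportCost

lemma intervalIntegrable_continuous_mul_stdDensity (hg : IsDensityGenerator g) {f : ℝ → ℝ}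
    (hf : Continuous f) (x y : ℝ) :
    IntervalIntegrable (fun z => f z * stdDensity g z) volume x y :=
  (integrable_stdDensity hg).intervalIntegrable.continuousOn_mul hf.continuousOn

lemma hasDerivAt_sq_div_two (x : ℝ) : HasDerivAt (fun z : ℝ => z ^ 2 / 2) x x := by
  have h := (hasDerivAt_pow 2 x).div_const 2
  simpa using h

/-- The substitution u = z²/2 is monotone on each side of 0, hence the base point 0 and the two
cases. Integrability of g near 0 comes from the same substitution. -/
lemma integral_generator_zero (hg : IsDensityGenerator g) (x : ℝ) :
    IntervalIntegrable (fun z => stdConst g * g z) volume 0 (x ^ 2 / 2) ∧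
      ∫ z in (0 : ℝ)..(x ^ 2 / 2), stdConst g * g z = ∫ z in (0 : ℝ)..x, z * stdDensity g z := by
  have hc : ContinuousOn (fun z : ℝ => z ^ 2 / 2) (uIcc 0 x) := by fun_prop
  have hd : ∀ y ∈ Ioo (min 0 x) (max 0 x), HasDerivAt (fun z : ℝ => z ^ 2 / 2) y y :=
    fun y _ => hasDerivAt_sq_div_two y
  have hfun : (fun z => ((fun u => stdConst g * g u) ∘ fun z : ℝ => z ^ 2 / 2) z * z)
      = fun z => z * stdDensity g z := by
    funext z
    simp [stdDensity, mul_comm]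
  have hint := intervalIntegrable_continuous_mul_stdDensity hg continuous_id 0 x
  simp only [id] at hint
  have h0 : (0 : ℝ) ^ 2 / 2 = 0 := by norm_num
  rcases le_total 0 x with hx | hx
  · have hs : ∀ y ∈ Ioo (min 0 x) (max 0 x), 0 ≤ y := fun y hy => by
      rw [min_eq_left hx] at hy
      exact hy.1.le
    have h1 := intervalIntegral.integrable_comp_mul_deriv_iff_of_deriv_nonneg
      (g := fun u => stdConst g * g u) hc hd hs
    have h2 := intervalIntegral.integral_comp_mul_deriv_of_deriv_nonneg
      (g := fun u => stdConst g * g u) hc hd hs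
    simp only [hfun, h0] at h1 h2
    exact ⟨h1.1 hint, h2.symm⟩
  · have hs : ∀ y ∈ Ioo (min 0 x) (max 0 x), y ≤ 0 := fun y hy => by
      rw [max_eq_left hx] at hy
      exact hy.2.le
    have h1 := intervalIntegral.integrable_comp_mul_deriv_iff_of_deriv_nonpos
      (g := fun u => stdConst g * g u) hc hd hs
    have h2 := intervalIntegral.integral_comp_mul_deriv_of_deriv_nonpos
      (g := fun u => stdConst g * g u) hc hd hs
    simp only [hfun, h0] at h1 h2
    exact ⟨h1.1 hint, h2.symm⟩

lemma integral_generator (hg : IsDensityGenerator g) (x y : ℝ) :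
    ∫ z in (x ^ 2 / 2)..(y ^ 2 / 2), stdConst g * g z = ∫ z in x..y, z * stdDensity g z := by
  have hint := fun x y => intervalIntegrable_continuous_mul_stdDensity hg continuous_id x y
  simp only [id] at hint
  obtain ⟨hx, hx'⟩ := integral_generator_zero hg x
  obtain ⟨hy, hy'⟩ := integral_generator_zero hg y
  rw [← intervalIntegral.integral_interval_sub_left hy hx, hx', hy',
    intervalIntegral.integral_interval_sub_left (hint 0 y) (hint 0 x)]

lemma transportCost_eq (hg : IsDensityGenerator g) (x y : ℝ) :
    transportCost g x y = y * (stdCDF g y - stdCDF g x) - ∫ z in x..y, z * stdDensity g z := by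
  have hint := intervalIntegrable_continuous_mul_stdDensity hg continuous_id x y
  simp only [id] at hint
  simp only [transportCost, sub_mul]
  rw [intervalIntegral.integral_sub
    (intervalIntegrable_continuous_mul_stdDensity hg continuous_const x y) hint,
    intervalIntegral.integral_const_mul, stdCDF_sub hg]

lemma continuous_transportCost (hg : IsDensityGenerator g) :
    Continuous fun w : ℝ × ℝ => transportCost g w.1 w.2 := by
  have hint := fun x y => intervalIntegrable_continuous_mul_stdDensity hg continuous_id x y
  simp only [id] at hint
  have hM := intervalIntegral.continuous_primitive hint 0
  have hF := continuous_stdCDF hg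
  have h : (fun w : ℝ × ℝ => transportCost g w.1 w.2) = fun w => w.2 * (stdCDF g w.2 - stdCDF g w.1)
      - ((∫ z in (0 : ℝ)..w.2, z * stdDensity g z) - ∫ z in (0 : ℝ)..w.1, z * stdDensity g z) := by
    funext w
    rw [transportCost_eq hg, intervalIntegral.integral_interval_sub_left (hint _ _) (hint _ _)]
  rw [h]
  exact (continuous_snd.mul ((hF.comp continuous_snd).sub (hF.comp continuous_fst))).sub
    ((hM.comp continuous_snd).sub (hM.comp continuous_fst))

lemma intervalIntegrable_transportCost (hg : IsDensityGenerator g) (c x y : ℝ) :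
    IntervalIntegrable (fun z => (c - z) * stdDensity g z) volume x y :=
  intervalIntegrable_continuous_mul_stdDensity hg (continuous_const.sub continuous_id) x y

/-- Moving the target from c to y adds y - c to the path of all mass between x and c; the mass
beyond c only adds cost. This yields monotonicity and at least linear growth in y. -/
lemma transportCost_add_le (hg : IsDensityGenerator g) {c y : ℝ} (x : ℝ) (hcy : c ≤ y) :
    transportCost g x c + (y - c) * (stdCDF g c - stdCDF g x) ≤ transportCost g x y := by
  have hint := intervalIntegrable_continuous_mul_stdDensity hg continuous_const x c
    (f := fun _ => y - c)
  have h1 : transportCost g x c + (y - c) * (stdCDF g c - stdCDF g x)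
      = ∫ z in x..c, (y - z) * stdDensity g z := by
    rw [transportCost, stdCDF_sub hg, ← intervalIntegral.integral_const_mul,
      ← intervalIntegral.integral_add (intervalIntegrable_transportCost hg c x c) hint]
    refine intervalIntegral.integral_congr fun z _ => ?_
    ring
  have h2 : 0 ≤ ∫ z in c..y, (y - z) * stdDensity g z :=
    intervalIntegral.integral_nonneg hcy fun z hz =>
      mul_nonneg (sub_nonneg.2 hz.2) (stdDensity_nonneg hg z)
  rw [h1, transportCost, ← intervalIntegral.integral_add_adjacent_intervals
    (intervalIntegrable_transportCost hg y x c) (intervalIntegrable_transportCost hg y c y)]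
  linarith

lemma transportCost_mono (hg : IsDensityGenerator g) {x c y : ℝ} (hxc : x ≤ c) (hcy : c ≤ y) :
    transportCost g x c ≤ transportCost g x y := by
  have h := transportCost_add_le hg x hcy
  have := mul_nonneg (sub_nonneg.2 hcy) (sub_nonneg.2 (stdCDF_mono hg hxc))
  linarith

@[simp]
lemma transportCost_self (x : ℝ) : transportCost g x x = 0 := by simp [transportCost]

lemma etaFeasible_eq (hg : IsDensityGenerator g) {θ α : ℝ} (hα : 0 < α) (hα1 : α < 1) :
    etaFeasible g θ α = {η | stdQuantile g (1 - α) ≤ η ∧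
      θ ≤ transportCost g (stdQuantile g (1 - α)) η} := by
  ext η
  have h : (1 / 2 * stdQuantile g (1 - α) ^ 2) = stdQuantile g (1 - α) ^ 2 / 2 := by ring
  rw [etaFeasible, mem_ofPred_eq, mem_ofPred_eq, h, integral_generator hg, transportCost_eq hg,
    stdCDF_stdQuantile hg (by linarith) (by linarith)]

lemma exists_isLeast_etaFeasible (hg : IsDensityGenerator g) {θ α : ℝ} (hθ : 0 < θ) (hα : 0 < α)
    (hα1 : α < 1) : ∃ η, IsLeast (etaFeasible g θ α) η := by
  rw [etaFeasible_eq hg hα hα1]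
  set q := stdQuantile g (1 - α) with hq
  have hΦq : stdCDF g q = 1 - α := stdCDF_stdQuantile hg (by linarith) (by linarith)
  have hclosed : IsClosed {η | q ≤ η ∧ θ ≤ transportCost g q η} :=
    (isClosed_le continuous_const continuous_id).inter (isClosed_le continuous_const
      ((continuous_transportCost hg).comp (continuous_const.prodMk continuous_id)))
  have hbdd : BddBelow {η | q ≤ η ∧ θ ≤ transportCost g q η} := ⟨q, fun η hη => hη.1⟩
  have hne : {η | q ≤ η ∧ θ ≤ transportCost g q η}.Nonempty := by
    obtain ⟨c, hc, hqc⟩ := (((tendsto_stdCDF_atTop hg).eventually_const_lt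
      (show 1 - α < 1 by linarith)).and (eventually_ge_atTop q)).exists
    have hpos : 0 < stdCDF g c - stdCDF g q := by linarith
    -- This shift makes the linear growth term equal to θ.
    have hle : c ≤ c + θ / (stdCDF g c - stdCDF g q) := by
      have := div_pos hθ hpos
      linarith
    have h := transportCost_add_le hg q hle
    have h0 := transportCost_mono hg le_rfl hqc
    rw [transportCost_self] at h0
    rw [add_sub_cancel_left, div_mul_cancel₀ _ hpos.ne'] at h
    exact ⟨_, hqc.trans hle, by linarith⟩
  exact ⟨_, hclosed.csInf_mem hne hbdd, fun η hη => csInf_le hbdd hη⟩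

end TransportCost

/-! ### Reduction to the standard law -/

section Elliptical

lemma ellipticalDensity_sub_mul {μ S : ℝ} (hS : 0 < S) (z : ℝ) :
    √S * ellipticalDensity μ S g (μ - √S * z) = stdDensity g z := by
  have hs : 0 < √S := Real.sqrt_pos.2 hS
  have harg : ∀ y : ℝ, 1 / 2 * ((y - μ) * S⁻¹ * (y - μ)) = ((y - μ) / √S) ^ 2 / 2 := fun y => by
    rw [div_pow, Real.sq_sqrt hS.le]
    ring
  have hmass : ∫ y : ℝ, g (((y - μ) / √S) ^ 2 / 2) = √S * ∫ z : ℝ, g (z ^ 2 / 2) := by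
    rw [integral_sub_right_eq_self (fun y : ℝ => g ((y / √S) ^ 2 / 2)) μ,
      Measure.integral_comp_div (fun y : ℝ => g (y ^ 2 / 2)), abs_of_pos hs, smul_eq_mul]
  have hz : ((μ - √S * z - μ) / √S) ^ 2 = z ^ 2 := by
    field_simp
    ring
  simp only [ellipticalDensity, harg, hmass, hz, stdDensity, stdConst, mul_inv]
  field_simp

/-- The reflected sign is harmless because the density is even in z; it turns the upper tail of x
into a lower tail of z. -/
lemma elliptical_eq_map {μ S : ℝ} (hS : 0 < S) :
    elliptical μ S g = (stdElliptical g).map fun z => μ - √S * z := by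
  have hs : 0 < √S := Real.sqrt_pos.2 hS
  have hT : Measurable fun z : ℝ => μ - √S * z := by fun_prop
  have hinj : Function.Injective fun z : ℝ => μ - √S * z := fun x y hxy => by
    simpa [hs.ne'] using hxy
  have hsurj : Function.Surjective fun z : ℝ => μ - √S * z := fun y =>
    ⟨(μ - y) / √S, by field_simp; ring⟩
  ext A hA
  rw [Measure.map_apply hT hA, stdElliptical, withDensity_apply _ (hT hA), elliptical,
    withDensity_apply _ hA]
  nth_rw 1 [← image_preimage_eq A hsurj]
  have hd : ∀ z : ℝ, HasDerivAt (fun z : ℝ => μ - √S * z) (-√S) z := fun z => by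
    simpa using ((hasDerivAt_id z).const_mul √S).const_sub μ
  rw [lintegral_image_eq_lintegral_abs_deriv_mul (hT hA)
    (fun z _ => (hd z).hasDerivWithinAt) hinj.injOn]
  refine lintegral_congr fun z => ?_
  rw [abs_neg, abs_of_pos hs, ← ENNReal.ofReal_mul hs.le, ellipticalDensity_sub_mul hS]

end Elliptical

/-! ### Lower and upper bounds on the Wasserstein distance -/

section Wasserstein

lemma measurable_mahalanobis (S : ℝ) : Measurable (mahalanobis S) := by
  unfold mahalanobis
  fun_prop

lemma mahalanobis_eq (S v : ℝ) : mahalanobis S v = |v| / √S := by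
  rw [mahalanobis, show v * S⁻¹ * v = v ^ 2 / S by ring, Real.sqrt_div (sq_nonneg v),
    Real.sqrt_sq_eq_abs]

/-- The lower bound for transport costs that is dual to moving mass across a threshold. -/
lemma mul_measure_le_wassersteinDist_add {E : Type*} [MeasurableSpace E] [Sub E] {N : E → ℝ}
    {P Q : Measure E} {A : Set E} (hA : MeasurableSet A) {c : ℝ≥0∞}
    {h : E → ℝ≥0∞} (hh : Measurable h)
    (hN : ∀ x ∈ A, ∀ y, c ≤ ENNReal.ofReal (N (x - y)) + h y) :
    c * P A ≤ wassersteinDist N P Q + ∫⁻ y, h y ∂Q := by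
  rw [wassersteinDist, ENNReal.iInf_add]
  refine le_iInf fun π => ?_
  rw [ENNReal.iInf_add]
  refine le_iInf fun hπ => ?_
  obtain ⟨rfl, rfl⟩ := hπ
  rw [lintegral_map hh measurable_snd, ← lintegral_add_right _ (show Measurable fun m : E × E => h m.2 from hh.comp measurable_snd),
    Measure.map_apply measurable_fst hA, ← lintegral_indicator_const (measurable_fst hA)]
  refine lintegral_mono fun m => ?_
  by_cases hm : m.1 ∈ A
  · rw [indicator_of_mem (show m ∈ Prod.fst ⁻¹' A from hm)]
    exact hN _ hm _
  · rw [indicator_of_notMem (show m ∉ Prod.fst ⁻¹' A from hm)]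
    exact zero_le

lemma wassersteinDist_map_le {E F : Type*} [MeasurableSpace E] [Sub E] [MeasurableSpace F]
    {N : E → ℝ} (hN : Measurable fun m : E × E => N (m.1 - m.2)) (ν : Measure F) {X Y : F → E}
    (hX : Measurable X) (hY : Measurable Y) :
    wassersteinDist N (ν.map X) (ν.map Y) ≤ ∫⁻ z, ENNReal.ofReal (N (X z - Y z)) ∂ν := by
  refine (iInf₂_le (ν.map fun z => (X z, Y z)) (show _ ∧ _ from ⟨?_, ?_⟩)).trans_eq ?_
  · rw [Measure.map_map measurable_fst (hX.prodMk hY)]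
    rfl
  · rw [Measure.map_map measurable_snd (hX.prodMk hY)]
    rfl
  · rw [lintegral_map hN.ennreal_ofReal (hX.prodMk hY)]

end Wasserstein

/-! ### Dual bound and explicit worst-case laws -/

section Duality

/-- The expectation of `z ↦ min (y - x) (max 0 (z - x))` in terms of the transport cost. -/
lemma lintegral_clamp (hg : IsDensityGenerator g) {x y : ℝ} (hxy : x ≤ y) :
    ∫⁻ z, ENNReal.ofReal (min (y - x) (max 0 (z - x))) ∂stdElliptical g
      = ENNReal.ofReal ((y - x) * (1 - stdCDF g x) - transportCost g x y) := by
  have hi := integrable_stdDensity hg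
  have hint : Integrable ((Ioi x).indicator fun z => (y - x) * stdDensity g z) :=
    (hi.const_mul _).indicator measurableSet_Ioi
  have hint' : Integrable ((Ioc x y).indicator fun z => (y - z) * stdDensity g z) := by
    rw [integrable_indicator_iff measurableSet_Ioc]
    exact (intervalIntegrable_iff_integrableOn_Ioc_of_le hxy).1
      (intervalIntegrable_transportCost hg y x y)
  have hpt : (fun z => min (y - x) (max 0 (z - x)) * stdDensity g z)
      = fun z => (Ioi x).indicator (fun z => (y - x) * stdDensity g z) z
        - (Ioc x y).indicator (fun z => (y - z) * stdDensity g z) z := by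
    funext z
    rcases le_or_gt z x with hzx | hzx
    · rw [indicator_of_notMem (by simpa using hzx), indicator_of_notMem (by simp [hzx]),
        max_eq_left (by linarith), min_eq_right (by linarith)]
      ring
    · rw [indicator_of_mem (by simpa using hzx), max_eq_right (by linarith)]
      rcases le_or_gt z y with hzy | hzy
      · rw [indicator_of_mem (show z ∈ Ioc x y from ⟨hzx, hzy⟩), min_eq_right (by linarith)]
        ring
      · rw [indicator_of_notMem (by simp [hzy]), min_eq_left (by linarith)]
        ring
  rw [lintegral_stdElliptical_ofReal hg (by fun_prop)
    (fun z => le_min (sub_nonneg.2 hxy) (le_max_left _ _)) (hpt ▸ hint.sub hint'), hpt,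
    integral_sub hint hint', integral_indicator measurableSet_Ioi,
    integral_indicator measurableSet_Ioc, integral_const_mul, integral_Ioi_stdDensity hg,
    transportCost, intervalIntegral.integral_of_le hxy]

/-- If moving the mass between the quantile `q` and `(μ - a) / √S` costs at least `θ`, then the
chance constraint holds throughout the ambiguity set. -/
lemma le_measure_Ici_of_le_transportCost (hg : IsDensityGenerator g) {θ α μ S a b q : ℝ}
    (hθ : 0 < θ) (hS : 0 < S) (hb : a + b * √S ≤ μ) (hq : stdCDF g q = 1 - α)
    (hqb : q < b) (hcost : θ ≤ transportCost g q b) {P : Measure ℝ}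
    (hP : P ∈ ambiguitySet (mahalanobis S) (elliptical μ S g) θ) :
    ENNReal.ofReal (1 - α) ≤ P (Ici a) := by
  obtain ⟨hprob, hW⟩ := hP
  have hs : 0 < √S := Real.sqrt_pos.2 hS
  have hsub : 0 < b - q := sub_pos.2 hqb
  have key := mul_measure_le_wassersteinDist_add (N := mahalanobis S) (P := P)
    (Q := elliptical μ S g) (measurableSet_Iio (a := a)) (c := ENNReal.ofReal (b - q))
    -- The dual potential: 1-Lipschitz in the standardized coordinate, 0 up to q and b - q from b
    -- on.
    (h := fun m => ENNReal.ofReal (min (b - q) (max 0 ((μ - m) / √S - q)))) (by fun_prop) (by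
      intro x hx y
      rw [← ENNReal.ofReal_add (show 0 ≤ mahalanobis S _ from Real.sqrt_nonneg _) (le_min hsub.le (le_max_left _ _))]
      refine ENNReal.ofReal_le_ofReal ?_
      rw [mahalanobis_eq]
      have hbx : b ≤ (μ - x) / √S := by
        rw [le_div_iff₀ hs]
        linarith [mem_Iio.1 hx]
      have h1 : (μ - x) / √S - (μ - y) / √S ≤ |x - y| / √S := by
        rw [← sub_div]
        refine div_le_div_of_nonneg_right ?_ hs.le
        rw [abs_sub_comm]
        exact (by ring : μ - x - (μ - y) = y - x).le.trans (le_abs_self _)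
      have h0 : 0 ≤ |x - y| / √S := by positivity
      rcases min_cases (b - q) (max 0 ((μ - y) / √S - q)) with ⟨h, _⟩ | ⟨h, _⟩
      · rw [h]
        linarith
      · rw [h]
        linarith [le_max_right 0 ((μ - y) / √S - q)])
  have hmap : ∫⁻ m, ENNReal.ofReal (min (b - q) (max 0 ((μ - m) / √S - q))) ∂elliptical μ S g
      = ENNReal.ofReal ((b - q) * α - transportCost g q b) := by
    rw [elliptical_eq_map hS, lintegral_map (by fun_prop) (by fun_prop)]
    have harg : ∀ z : ℝ, (μ - (μ - √S * z)) / √S = z := fun z => by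
      field_simp
      ring
    simp only [harg]
    rw [lintegral_clamp hg hqb.le, hq, sub_sub_cancel]
  -- Needed because `ENNReal.ofReal` truncates at 0 and is additive only on nonnegative terms.
  have hnonneg : 0 ≤ (b - q) * α - transportCost g q b := by
    have h : transportCost g q b ≤ (b - q) * (stdCDF g b - stdCDF g q) := by
      rw [stdCDF_sub hg, ← intervalIntegral.integral_const_mul]
      refine intervalIntegral.integral_mono_on hqb.le (intervalIntegrable_transportCost hg b q b)
        ((integrable_stdDensity hg).intervalIntegrable.const_mul _) fun z hz => ?_
      exact mul_le_mul_of_nonneg_right (by linarith [hz.1]) (stdDensity_nonneg hg z)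
    have h1 : stdCDF g b - stdCDF g q ≤ α := by
      have : stdCDF g b ≤ 1 :=
        (stdCDF_mono hg).ge_of_tendsto (tendsto_stdCDF_atTop hg) b
      linarith
    have h2 := mul_le_mul_of_nonneg_left h1 hsub.le
    linarith
  have hbound : ENNReal.ofReal (b - q) * P (Iio a) ≤ ENNReal.ofReal ((b - q) * α) :=
    calc _ ≤ ENNReal.ofReal θ + ENNReal.ofReal ((b - q) * α - transportCost g q b) :=
          (key.trans_eq (by rw [hmap])).trans (add_le_add_left hW _)
      _ ≤ _ := by
          rw [← ENNReal.ofReal_add hθ.le hnonneg]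
          exact ENNReal.ofReal_le_ofReal (by linarith)
  have hIio : P (Iio a) ≤ ENNReal.ofReal α := by
    rw [ENNReal.ofReal_mul hsub.le] at hbound
    exact (ENNReal.mul_le_mul_iff_right (by simpa using hqb) ENNReal.ofReal_ne_top).1 hbound
  have hα0 : 0 ≤ α := by
    have : stdCDF g q ≤ 1 := (stdCDF_mono hg).ge_of_tendsto (tendsto_stdCDF_atTop hg) q
    linarith
  rw [← compl_Iio, prob_compl_eq_one_sub measurableSet_Iio, ENNReal.ofReal_sub _ hα0,
    ENNReal.ofReal_one]
  exact tsub_le_tsub_left hIio 1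

/-- If moving to `y` the mass between `x` and `y` costs at most `θ`, then doing so defines a
distribution in the ambiguity set. -/
lemma exists_mem_ambiguitySet (hg : IsDensityGenerator g) {θ μ S x y : ℝ} (hS : 0 < S)
    (hxy : x ≤ y) (hcost : transportCost g x y ≤ θ) :
    ∃ P ∈ ambiguitySet (mahalanobis S) (elliptical μ S g) θ,
      ∀ a, μ < a + y * √S → P (Ici a) ≤ ENNReal.ofReal (stdCDF g x) := by
  have hs : 0 < √S := Real.sqrt_pos.2 hS
  have := isProbabilityMeasure_stdElliptical hg
  -- T collapses (x, y] to y and fixes every other point, so T z < y forces z ≤ x.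
  set T : ℝ → ℝ := fun z => z + (Ioc x y).indicator (fun z => y - z) z with hT
  have hTm : Measurable T :=
    measurable_id.add ((measurable_const.sub measurable_id).indicator measurableSet_Ioc)
  have hXm : Measurable fun z => μ - √S * T z := measurable_const.sub (hTm.const_mul _)
  refine ⟨(stdElliptical g).map fun z => μ - √S * T z,
    ⟨Measure.isProbabilityMeasure_map hXm.aemeasurable, ?_⟩, fun a ha => ?_⟩
  · rw [elliptical_eq_map hS]
    refine (wassersteinDist_map_le ((measurable_mahalanobis S).comp (by fun_prop)) _ hXm
      (by fun_prop)).trans ?_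
    have hIm : Measurable ((Ioc x y).indicator fun z => y - z) :=
      (measurable_const.sub measurable_id).indicator measurableSet_Ioc
    have hN : ∀ z, mahalanobis S (μ - √S * T z - (μ - √S * z))
        = (Ioc x y).indicator (fun z => y - z) z := fun z => by
      have h0 : 0 ≤ (Ioc x y).indicator (fun z => y - z) z :=
        indicator_nonneg (fun z hz => sub_nonneg.2 hz.2) z
      rw [mahalanobis_eq, show μ - √S * T z - (μ - √S * z)
        = -(√S * (Ioc x y).indicator (fun z => y - z) z) by rw [hT]; ring, abs_neg,
        abs_of_nonneg (mul_nonneg hs.le h0), mul_div_cancel_left₀ _ hs.ne']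
    have hmul : (fun z => (Ioc x y).indicator (fun z => y - z) z * stdDensity g z)
        = (Ioc x y).indicator fun z => (y - z) * stdDensity g z := by
      funext z
      by_cases hz : z ∈ Ioc x y
      · simp [hz]
      · simp [hz]
    simp only [hN]
    rw [lintegral_stdElliptical_ofReal hg hIm
      (indicator_nonneg fun z hz => sub_nonneg.2 hz.2), hmul,
      integral_indicator measurableSet_Ioc, ← intervalIntegral.integral_of_le hxy]
    · exact ENNReal.ofReal_le_ofReal hcost
    · rw [hmul, integrable_indicator_iff measurableSet_Ioc]
      exact (intervalIntegrable_iff_integrableOn_Ioc_of_le hxy).1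
        (intervalIntegrable_transportCost hg y x y)
  · rw [Measure.map_apply hXm measurableSet_Ici, ← stdElliptical_Iic hg]
    refine measure_mono fun z hz => ?_
    have hz' : a ≤ μ - √S * T z := hz
    have hTy : T z < y := by
      have : √S * T z < √S * y := by linarith
      exact lt_of_mul_lt_mul_left this hs.le
    by_contra! h
    have hxz : x < z := not_le.1 h
    by_cases hzy : z ≤ y
    · have : T z = y := by
        rw [hT]
        simp [hxz, hzy]
      linarith
    · have : T z = z := by
        rw [hT]
        simp [hzy]
      linarith

end Duality

end WassersteinChance

end

/-! ### The equivalence -/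

open WassersteinChance in
theorem mainTheorem3 (g : ℝ → ℝ) (hg : WassersteinChance.IsDensityGenerator g)
    (θ : ℝ) (hθ : 0 < θ) (α : ℝ) (hα : 0 < α) (hα' : α ≤ 1 / 2) :
    ∃ ηstar : ℝ, IsLeast (WassersteinChance.etaFeasible g θ α) ηstar ∧
      ∀ (μ S : ℝ), 0 < S → ∀ a : ℝ,
        (ENNReal.ofReal (1 - α) ≤
            ⨅ P ∈ WassersteinChance.ambiguitySet (WassersteinChance.mahalanobis S)
              (WassersteinChance.elliptical μ S g) θ, P (Set.Ici a)) ↔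
          a + ηstar * √S ≤ μ := by
  have hα1 : α < 1 := by linarith
  obtain ⟨η, hη⟩ := exists_isLeast_etaFeasible hg hθ hα hα1
  refine ⟨η, hη, fun μ S hS a => ?_⟩
  rw [etaFeasible_eq hg hα hα1] at hη
  obtain ⟨⟨hqη, hcost⟩, hleast⟩ := hη
  set q := stdQuantile g (1 - α) with hq
  have hΦq : stdCDF g q = 1 - α := stdCDF_stdQuantile hg (by linarith) (by linarith)
  have hlt : q < η := hqη.lt_of_ne fun h => by
    rw [← h, transportCost_self] at hcost
    linarith
  have hs : 0 < √S := Real.sqrt_pos.2 hS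
  constructor
  · intro h
    by_contra! hμ
    -- The threshold may lie below q; the maximum keeps b in the range where minimality of η
    -- applies.
    set b := max q ((μ - a) / √S) with hb
    have hbη : b < η := max_lt hlt (by rw [div_lt_iff₀ hs]; linarith)
    have hFb : transportCost g q b < θ := by
      by_contra! hge
      exact absurd (hleast ⟨le_max_left _ _, hge⟩) (not_le.2 hbη)
    -- Widening on the left makes Φ(q - ε) < 1 - α strict; widening on the right puts the moved mass
    -- strictly outside the closed half-line [a, ∞).
    have htend : Filter.Tendsto (fun ε : ℝ => transportCost g (q - ε) (b + ε))
        (nhdsWithin 0 (Set.Ioi 0)) (nhds (transportCost g q b)) := by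
      have hc : Continuous fun ε : ℝ => transportCost g (q - ε) (b + ε) :=
        (continuous_transportCost hg).comp
          ((continuous_const.sub continuous_id).prodMk (continuous_const.add continuous_id))
      simpa using (hc.tendsto 0).mono_left nhdsWithin_le_nhds
    obtain ⟨ε, hε, hε0⟩ := ((htend.eventually_lt_const hFb).and self_mem_nhdsWithin).exists
    replace hε0 : 0 < ε := hε0
    have hqb : q ≤ b := le_max_left _ _
    obtain ⟨P, hP, hPa⟩ := exists_mem_ambiguitySet (μ := μ) hg hS
      (show q - ε ≤ b + ε by linarith) hε.le
    have hμb : μ < a + (b + ε) * √S := by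
      have h1 : (μ - a) / √S < b + ε := (le_max_right q _).trans_lt (by linarith)
      rw [div_lt_iff₀ hs] at h1
      linarith
    have h2 := (h.trans (iInf₂_le P hP)).trans (hPa a hμb)
    have h3 : stdCDF g (q - ε) < 1 - α :=
      stdCDF_lt_of_lt_stdQuantile hg (by linarith) (by linarith)
    exact absurd h2 (not_le.2 ((ENNReal.ofReal_lt_ofReal_iff (by linarith)).2 h3))
  · intro h
    exact le_iInf₂ fun P hP => le_measure_Ici_of_le_transportCost hg hθ hS h hΦq hlt hcost hP
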